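/- Let $k \ge 2$ be an integer and let $\varepsilon > 0$ be a real number. Then there exist constants $c_1, c_2 > 0$ and $n_0 \in \mathbb{N}$, depending only on $k$ and $\varepsilon$, such that the following holds. Let $G$ be a finite simple graph with $n \ge n_0$ vertices and $m \ge 1$ edges, where $d(v)$ denotes the degree of the vertex $v$, and suppose that $$\sum_{v \in V(G)} d(v)^2 \;\ge\; 2\left(1 - \frac{1}{k} + \varepsilon\right) m n .$$ Then $G$ contains at least $c_1 n^{k+1}$ copies of the complete graph $K_{k+1}$ (that is, subgraphs isomorphic to $K_{k+1}$), and, for some integer $t \ge c_2 \log n$, $G$ contains a copy of $K_{k+1}[t]$, the complete $(k+1)$-partite graph in which each part has exactly $t$ vertices, as a (not necessarily induced) subgraph. -/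

import Mathlib

universe u

/-! Write D = 2m. In a K_{k+1}-free graph, Motzkin–Straus and Cauchy–Schwarz bound the adjacency
form by √((1 - 1/k)D) times the squared norm; testing this on the all-ones and degree vectors gives
∑ d(v)² ≤ (1 - 1/k)nD (`sum_sq_degree_le_of_cliqueFree`).

The hypothesis beats this bound by εnD. Pulling G back along all maps from a set of constant size M
keeps most of the excess on average, and a positive excess on M vertices forces a K_{k+1}. Averaging
gives at least D n^(k-1) / M^(k+2) labelled cliques (`sum_degree_mul_le_card_cliqueTuples`).

Sparse graphs are excluded: the hypothesis makes ∑ d(v)² so large that there are at least 2εnD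
ordered triangles, while there are at most D^(3/2), so D ≥ 4ε²n² (`sq_card_le_sum_degree`). Hence
order n^(k+1) cliques. Repeated pigeonhole on clique extensions then yields the logarithmic blow-up
(`exists_blowup_of_many_cliques`). -/

/-! ### Degree squares in clique-free graphs -/

-- Weight can be moved between nonadjacent vertices of the support without decreasing the form,
-- until the support is a clique of at most k vertices; there Cauchy–Schwarz finishes.
open Matrix in
theorem motzkin_straus {V : Type*} [Fintype V] [DecidableEq V] (G : SimpleGraph V)
    [DecidableRel G.Adj] {k : ℕ} (hk : 0 < k) (hG : G.CliqueFree (k + 1)) (y : V → ℝ)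
    (hy : ∀ v, 0 ≤ y v) :
    y ⬝ᵥ (G.adjMatrix ℝ *ᵥ y) ≤ (1 - 1 / (k : ℝ)) * (∑ v, y v) ^ 2 := by
  have hk' : (0 : ℝ) < k := by exact_mod_cast hk
  generalize hs : (Finset.univ.filter fun v => y v ≠ 0).card = N
  induction N using Nat.strong_induction_on generalizing y with
  | _ N ih =>
  set s := Finset.univ.filter fun v => y v ≠ 0 with hsdef
  by_cases hcl : G.IsClique (s : Set V)
  · have hcard : s.card ≤ k := by
      by_contra! h
      obtain ⟨t, hts, htc⟩ := Finset.exists_subset_card_eq (Nat.succ_le_of_lt h)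
      exact hG t ⟨hcl.subset (by exact_mod_cast hts), htc⟩
    have h1 : y ⬝ᵥ (G.adjMatrix ℝ *ᵥ y) = (∑ v, y v) ^ 2 - ∑ v, y v ^ 2 := by
      rw [sq, Finset.sum_mul, ← Finset.sum_sub_distrib]
      refine Finset.sum_congr rfl fun u _ => ?_
      by_cases hu : y u = 0
      · simp [hu]
      have : (G.adjMatrix ℝ *ᵥ y) u = (∑ v, y v) - y u := by
        rw [← Finset.sum_erase_eq_sub (Finset.mem_univ u), SimpleGraph.adjMatrix_mulVec_apply]
        refine Finset.sum_subset_zero_on_sdiff ?_ ?_ fun _ _ => rfl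
        · intro v hv
          simp only [SimpleGraph.mem_neighborFinset] at hv
          simp [hv.ne']
        · intro v hv
          simp only [Finset.mem_sdiff, Finset.mem_erase, Finset.mem_univ,
            SimpleGraph.mem_neighborFinset] at hv
          by_contra h
          exact hv.2 (hcl (by simp [hsdef, hu]) (by simp [hsdef, h]) hv.1.1.symm)
      rw [this]; ring
    have h2 : (∑ v, y v) ^ 2 ≤ k * ∑ v, y v ^ 2 := by
      have e1 : ∑ v, y v = ∑ v ∈ s, y v := by simp [hsdef, Finset.sum_filter_ne_zero]
      rw [e1]
      calc (∑ v ∈ s, y v) ^ 2 ≤ s.card * ∑ v ∈ s, y v ^ 2 := sq_sum_le_card_mul_sum_sq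
        _ ≤ k * ∑ v, y v ^ 2 := by
          gcongr
          exact Finset.subset_univ _
    rw [h1]
    have h3 : (∑ v, y v) ^ 2 / k ≤ ∑ v, y v ^ 2 := by rw [div_le_iff₀ hk']; linarith
    have : (1 - 1 / (k : ℝ)) * (∑ v, y v) ^ 2 = (∑ v, y v) ^ 2 - (∑ v, y v) ^ 2 / k := by ring
    linarith
  · obtain ⟨u, v, hu, hv, huv, hadj, hle⟩ : ∃ u v, y u ≠ 0 ∧ y v ≠ 0 ∧ u ≠ v ∧ ¬ G.Adj u v ∧
        (G.adjMatrix ℝ *ᵥ y) v ≤ (G.adjMatrix ℝ *ᵥ y) u := by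
      simp only [SimpleGraph.IsClique, Set.Pairwise, not_forall, hsdef] at hcl
      obtain ⟨u, hu, v, hv, huv, hadj⟩ := hcl
      simp only [ne_eq, Finset.coe_filter, Finset.mem_univ, true_and, Set.mem_ofPred_eq] at hu hv
      rcases le_total ((G.adjMatrix ℝ *ᵥ y) v) ((G.adjMatrix ℝ *ᵥ y) u) with h | h
      · exact ⟨u, v, hu, hv, huv, hadj, h⟩
      · exact ⟨v, u, hv, hu, huv.symm, fun h' => hadj h'.symm, h⟩
    -- Move all the weight of v onto u. Nonadjacency kills the term quadratic in z, the choice of u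
    -- makes the linear term nonnegative, and v leaves the support.
    set z : V → ℝ := y v • (Pi.single u 1 - Pi.single v 1) with hz
    have hsum : ∑ w, (y + z) w = ∑ w, y w := by
      simp [hz, Finset.sum_add_distrib, ← Finset.mul_sum, Finset.sum_sub_distrib]
    have hAz : z ⬝ᵥ (G.adjMatrix ℝ *ᵥ z) = 0 := by
      have hadj' : ¬ G.Adj v u := fun h => hadj h.symm
      simp [hz, smul_dotProduct, sub_dotProduct, mulVec_smul, mulVec_sub, hadj, hadj']
    have hsymm : y ⬝ᵥ (G.adjMatrix ℝ *ᵥ z) = z ⬝ᵥ (G.adjMatrix ℝ *ᵥ y) := by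
      rw [dotProduct_mulVec, ← mulVec_transpose, SimpleGraph.transpose_adjMatrix, dotProduct_comm]
    have hzy : 0 ≤ z ⬝ᵥ (G.adjMatrix ℝ *ᵥ y) := by
      simp only [hz, smul_dotProduct, sub_dotProduct, single_dotProduct, one_mul, smul_eq_mul]
      exact mul_nonneg (hy v) (by linarith)
    have hq : y ⬝ᵥ (G.adjMatrix ℝ *ᵥ y) ≤ (y + z) ⬝ᵥ (G.adjMatrix ℝ *ᵥ (y + z)) := by
      rw [mulVec_add, add_dotProduct, dotProduct_add, dotProduct_add, hAz, hsymm]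
      linarith
    have hyz : ∀ w, (y + z) w = if w = v then 0 else if w = u then y u + y v else y w := by
      intro w
      by_cases h1 : w = v
      · subst h1; simp [hz, huv.symm]
      · by_cases h2 : w = u
        · subst h2; simp [hz, huv]
        · simp [hz, h1, h2]
    refine hq.trans ?_
    rw [← hsum]
    refine ih _ ?_ (y + z) (fun w => ?_) rfl
    · rw [← hs]
      refine Finset.card_lt_card ?_
      rw [Finset.ssubset_iff_of_subset]
      · exact ⟨v, by simp [hsdef, hv], by simp [hyz]⟩
      · intro w hw
        simp only [Finset.mem_filter, Finset.mem_univ, true_and, hyz, hsdef] at hw ⊢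
        by_cases h2 : w = u
        · rwa [h2]
        · simp only [h2, if_false] at hw
          split_ifs at hw <;> simp_all
    · rw [hyz]
      have := hy u; have := hy v; have := hy w
      split_ifs <;> linarith

-- Cauchy–Schwarz over ordered pairs, using that adjacency entries are idempotent; the second factor
-- is the Motzkin–Straus form at the squares of the entries of x.
open Matrix in
theorem sq_dotProduct_adjMatrix_mulVec_le {V : Type*} [Fintype V] [DecidableEq V]
    (G : SimpleGraph V) [DecidableRel G.Adj] {k : ℕ} (hk : 0 < k) (hG : G.CliqueFree (k + 1))
    (x : V → ℝ) :
    (x ⬝ᵥ (G.adjMatrix ℝ *ᵥ x)) ^ 2 ≤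
      (∑ v, (G.degree v : ℝ)) * (1 - 1 / (k : ℝ)) * (∑ v, x v ^ 2) ^ 2 := by
  have e1 : ∀ y : V → ℝ, y ⬝ᵥ (G.adjMatrix ℝ *ᵥ y) =
      ∑ p : V × V, G.adjMatrix ℝ p.1 p.2 * (y p.1 * y p.2) := by
    intro y
    rw [Fintype.sum_prod_type]
    simp only [dotProduct, mulVec, Finset.mul_sum]
    exact Finset.sum_congr rfl fun _ _ => Finset.sum_congr rfl fun _ _ => by ring
  have e2 : ∑ v, (G.degree v : ℝ) = ∑ p : V × V, G.adjMatrix ℝ p.1 p.2 ^ 2 := by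
    rw [Fintype.sum_prod_type]
    refine Finset.sum_congr rfl fun v _ => ?_
    simp [← SimpleGraph.card_neighborFinset_eq_degree, SimpleGraph.neighborFinset_eq_filter]
  have h := motzkin_straus G hk hG (fun v => x v ^ 2) fun v => sq_nonneg _
  rw [e1] at h
  rw [e1, mul_assoc]
  have hcs := Finset.sum_mul_sq_le_sq_mul_sq (Finset.univ : Finset (V × V))
    (fun p => G.adjMatrix ℝ p.1 p.2) (fun p => G.adjMatrix ℝ p.1 p.2 * (x p.1 * x p.2))
  have e3 : ∀ p : V × V, G.adjMatrix ℝ p.1 p.2 * (G.adjMatrix ℝ p.1 p.2 * (x p.1 * x p.2)) =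
      G.adjMatrix ℝ p.1 p.2 * (x p.1 * x p.2) := by
    intro p
    by_cases hp : G.Adj p.1 p.2 <;> simp [hp]
  have e4 : ∀ p : V × V, (G.adjMatrix ℝ p.1 p.2 * (x p.1 * x p.2)) ^ 2 =
      G.adjMatrix ℝ p.1 p.2 * (x p.1 ^ 2 * x p.2 ^ 2) := by
    intro p
    by_cases hp : G.Adj p.1 p.2 <;> simp [hp, mul_pow]
  simp only [e3, e4] at hcs
  rw [← e2] at hcs
  exact hcs.trans (mul_le_mul_of_nonneg_left h (by positivity))

-- The sum of squared degrees is the adjacency form paired between the all-ones vector and the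
-- degree vector, so polarization brings in the bound on the form.
open Matrix in
theorem sum_sq_degree_le_of_cliqueFree {V : Type*} [Fintype V]
    (G : SimpleGraph V) [DecidableRel G.Adj] {k : ℕ} (hk : 2 ≤ k) (hG : G.CliqueFree (k + 1)) :
    ∑ v, (G.degree v : ℝ) ^ 2 ≤
      (1 - 1 / (k : ℝ)) * Fintype.card V * ∑ v, (G.degree v : ℝ) := by
  classical
  set D := ∑ v, (G.degree v : ℝ) with hD
  have hD0 : 0 ≤ D := by positivity
  have hα : (0 : ℝ) < 1 - 1 / (k : ℝ) := by
    have : (2 : ℝ) ≤ k := by exact_mod_cast hk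
    rw [sub_pos, div_lt_one] <;> linarith
  rcases hD0.eq_or_lt with h0 | hpos
  · have : ∀ v, (G.degree v : ℝ) = 0 := by
      have := (Finset.sum_eq_zero_iff_of_nonneg (s := Finset.univ)
        (f := fun v => (G.degree v : ℝ)) (fun _ _ => by positivity)).1 h0.symm
      simpa using this
    simp [this, ← h0]
  set L := √(D * (1 - 1 / (k : ℝ))) with hL
  have hLpos : 0 < L := Real.sqrt_pos.2 (by positivity)
  have hL2 : L ^ 2 = D * (1 - 1 / (k : ℝ)) := Real.sq_sqrt (by positivity)
  have key : ∀ x : V → ℝ, |x ⬝ᵥ (G.adjMatrix ℝ *ᵥ x)| ≤ L * ∑ v, x v ^ 2 := by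
    intro x
    refine abs_le_of_sq_le_sq ?_ (by positivity)
    rw [mul_pow, hL2]
    exact sq_dotProduct_adjMatrix_mulVec_le G (by omega) hG x
  set d : V → ℝ := fun v => (G.degree v : ℝ) with hd
  -- Scaling by L makes the norms of c and d agree in the extremal case, so polarization loses
  -- nothing.
  set c : V → ℝ := fun _ => L with hc
  have hAc : G.adjMatrix ℝ *ᵥ c = L • d := by
    ext v; simp [hc, hd, SimpleGraph.adjMatrix_mulVec_apply, mul_comm]
  have hsymm : c ⬝ᵥ (G.adjMatrix ℝ *ᵥ d) = d ⬝ᵥ (G.adjMatrix ℝ *ᵥ c) := by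
    rw [dotProduct_mulVec, ← mulVec_transpose, SimpleGraph.transpose_adjMatrix, dotProduct_comm]
  have hdc : d ⬝ᵥ (G.adjMatrix ℝ *ᵥ c) = L * ∑ v, (G.degree v : ℝ) ^ 2 := by
    rw [hAc]; simp [hd, dotProduct, Finset.mul_sum, sq, mul_left_comm]
  have h1 := (abs_le.1 (key (c + d))).2
  have h2 := (abs_le.1 (key (c - d))).1
  rw [mulVec_add, add_dotProduct, dotProduct_add, dotProduct_add, hsymm, hdc] at h1
  rw [mulVec_sub, sub_dotProduct, dotProduct_sub, dotProduct_sub, hsymm, hdc] at h2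
  have h3 : ∑ v, (c + d) v ^ 2 + ∑ v, (c - d) v ^ 2 =
      2 * (Fintype.card V * L ^ 2 + ∑ v, (G.degree v : ℝ) ^ 2) := by
    rw [← Finset.sum_add_distrib]
    have : ∀ v, (c + d) v ^ 2 + (c - d) v ^ 2 = 2 * L ^ 2 + 2 * (G.degree v : ℝ) ^ 2 := by
      intro v; simp [hc, hd]; ring
    simp only [this, Finset.sum_add_distrib, ← Finset.mul_sum]
    simp; ring
  have h4 : L * ∑ v, (G.degree v : ℝ) ^ 2 ≤ L * (Fintype.card V * L ^ 2) := by
    have : L * ∑ v, (c + d) v ^ 2 + L * ∑ v, (c - d) v ^ 2 =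
      L * (2 * (Fintype.card V * L ^ 2 + ∑ v, (G.degree v : ℝ) ^ 2)) := by rw [← mul_add, h3]
    nlinarith
  have h5 := le_of_mul_le_mul_left h4 hLpos
  rw [hL2] at h5
  linarith

/-! ### Blow-ups from many cliques -/

/-- Pigeonhole on neighbourhoods: a dense bipartite relation between a small set `α` and a large
set `V` contains a complete bipartite pattern with both sides of size `t`. -/
theorem exists_complete_bipartite {α V : Type*} [Fintype α] [Fintype V] [Nonempty α]
    (R : α → V → Prop) [∀ a, DecidablePred (R a)] {β : ℝ} (hβ : 0 < β)
    (hR : ∀ a, β * Fintype.card V ≤ ((Finset.univ.filter fun v => R a v).card : ℝ)) {t : ℕ}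
    (ht : (t : ℝ) ≤ β / 2 * Fintype.card α)
    (ht' : (t : ℝ) * 2 ^ Fintype.card α ≤ β / 2 * Fintype.card V) :
    ∃ (e : Fin t ↪ α) (w : Fin t ↪ V), ∀ a b, R (e a) (w b) := by
  classical
  rcases Nat.eq_zero_or_pos t with rfl | htpos
  · exact ⟨Function.Embedding.ofIsEmpty, Function.Embedding.ofIsEmpty, fun a => a.elim0⟩
  have hα : (0 : ℝ) < Fintype.card α := by exact_mod_cast Fintype.card_pos
  have ht0 : (0 : ℝ) < t := by exact_mod_cast htpos
  let N : V → Finset α := fun v => Finset.univ.filter fun a => R a v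
  set good := Finset.univ.filter fun v : V => β / 2 * Fintype.card α ≤ ((N v).card : ℝ)
    with hgood
  have hsum : ∑ v, ((N v).card : ℝ) =
      ∑ a, ((Finset.univ.filter fun v => R a v).card : ℝ) := by
    simp only [N, Finset.card_filter, Nat.cast_sum]
    exact Finset.sum_comm
  have hlow : Fintype.card α * (β * Fintype.card V) ≤ ∑ v, ((N v).card : ℝ) := by
    rw [hsum]
    calc Fintype.card α * (β * Fintype.card V) = ∑ _a : α, β * (Fintype.card V : ℝ) := by simp
      _ ≤ _ := Finset.sum_le_sum fun a _ => hR a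
  have hup : ∑ v, ((N v).card : ℝ) ≤
      good.card * Fintype.card α + Fintype.card V * (β / 2 * Fintype.card α) := by
    calc ∑ v, ((N v).card : ℝ)
        ≤ ∑ v, ((if v ∈ good then (Fintype.card α : ℝ) else 0) + β / 2 * Fintype.card α) := by
          refine Finset.sum_le_sum fun v _ => ?_
          split_ifs with hv
          · have : ((N v).card : ℝ) ≤ Fintype.card α := by exact_mod_cast Finset.card_le_univ _
            have : 0 ≤ β / 2 * Fintype.card α := by positivity
            linarith
          · simp only [hgood, Finset.mem_filter, Finset.mem_univ, true_and, not_le] at hv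
            linarith
      _ = _ := by simp [Finset.sum_add_distrib]
  have hgc : β / 2 * Fintype.card V ≤ good.card := by
    have : Fintype.card α * (β / 2 * Fintype.card V) ≤ Fintype.card α * (good.card : ℝ) := by
      linarith
    exact le_of_mul_le_mul_left this hα
  -- There are only 2^|α| possible neighbourhoods, so at least t good vertices share one, namely S;
  -- being good makes S itself large.
  obtain ⟨S, -, hS⟩ := Finset.exists_le_card_fiber_of_nsmul_le_card_of_maps_to
    (s := good) (t := (Finset.univ : Finset (Finset α))) (f := N) (b := (t : ℝ))
    (fun _ _ => Finset.mem_univ _) Finset.univ_nonempty (by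
      simp only [Finset.card_univ, Fintype.card_finset, nsmul_eq_mul, Nat.cast_pow, Nat.cast_ofNat]
      linarith)
  have hScard : t ≤ S.card := by
    have : (0 : ℝ) < ((good.filter fun v => N v = S).card : ℝ) := ht0.trans_le hS
    obtain ⟨v, hv⟩ := Finset.card_pos.1 (Nat.cast_pos.1 this)
    simp only [Finset.mem_filter, hgood, Finset.mem_univ, true_and] at hv
    rw [hv.2] at hv
    exact_mod_cast ht.trans hv.1
  have hFcard : t ≤ (good.filter fun v => N v = S).card := by exact_mod_cast hS
  refine ⟨(Fin.castLEEmb hScard).trans (S.equivFin.symm.toEmbedding.trans (.subtype _)),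
    (Fin.castLEEmb hFcard).trans
      ((good.filter fun v => N v = S).equivFin.symm.toEmbedding.trans (.subtype _)),
    fun a b => ?_⟩
  have h1 := (S.equivFin.symm (Fin.castLE hScard a)).2
  have h2 := ((good.filter fun v => N v = S).equivFin.symm (Fin.castLE hFcard b)).2
  rw [Finset.mem_filter] at h2
  have h3 : (S.equivFin.symm (Fin.castLE hScard a) : α) ∈
      N ((good.filter fun v => N v = S).equivFin.symm (Fin.castLE hFcard b)) := by
    rw [h2.2]; exact h1
  simpa [N] using h3

/-- A positive proportion of the `(r + 1)`-tuples restricts to a positive proportion of `r`-tuples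
having many extensions. -/
theorem card_filter_cons_ge {V : Type*} [Fintype V] [DecidableEq V] {r : ℕ}
    (F : Finset (Fin (r + 1) → V)) {c : ℝ} (hV : 0 < Fintype.card V)
    (hF : c * (Fintype.card V : ℝ) ^ (r + 1) ≤ F.card) :
    c / 2 * (Fintype.card V : ℝ) ^ r ≤
      ((Finset.univ.filter fun h : Fin r → V => c / 2 * Fintype.card V ≤
        ((Finset.univ.filter fun v : V => (Fin.cons v h : Fin (r + 1) → V) ∈ F).card : ℝ)).card
          : ℝ) := by
  set n : ℝ := (Fintype.card V : ℝ) with hn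
  have hnpos : 0 < n := Nat.cast_pos.2 hV
  set ext : (Fin r → V) → ℝ := fun h =>
    ((Finset.univ.filter fun v : V => (Fin.cons v h : Fin (r + 1) → V) ∈ F).card : ℝ) with hext
  set good := Finset.univ.filter fun h : Fin r → V => c / 2 * n ≤ ext h with hgood
  have hsum : (F.card : ℝ) = ∑ h, ext h := by
    have h1 : (F.card : ℝ) = ∑ f : Fin (r + 1) → V, if f ∈ F then (1 : ℝ) else 0 := by simp
    rw [h1, ← (Fin.consEquiv fun _ : Fin (r + 1) => V).sum_comp, Fintype.sum_prod_type,
      Finset.sum_comm]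
    refine Finset.sum_congr rfl fun h _ => ?_
    simp only [hext, Finset.card_filter, Nat.cast_sum]
    refine Finset.sum_congr rfl fun v _ => ?_
    simp only [Nat.cast_ite, Nat.cast_one, Nat.cast_zero]
    exact if_congr Iff.rfl rfl rfl
  by_cases hc : c < 0
  · have : c / 2 * n ^ r ≤ 0 := mul_nonpos_of_nonpos_of_nonneg (by linarith) (by positivity)
    exact this.trans (by positivity)
  push Not at hc
  have hup : ∑ h, ext h ≤ good.card * n + n ^ r * (c / 2 * n) := by
    calc ∑ h, ext h ≤ ∑ h, ((if h ∈ good then n else 0) + c / 2 * n) := by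
          refine Finset.sum_le_sum fun h _ => ?_
          split_ifs with hh
          · have h1 : ext h ≤ n := by
              simp only [hext, hn]; exact_mod_cast Finset.card_le_univ _
            have : 0 ≤ c / 2 * n := by positivity
            linarith
          · simp only [hgood, Finset.mem_filter, Finset.mem_univ, true_and, not_le] at hh
            linarith
      _ = _ := by simp [Finset.sum_add_distrib, hn]
  have : n * (c / 2 * n ^ r) ≤ n * good.card := by
    have e : c * n ^ (r + 1) = n * (c / 2 * n ^ r) + n ^ r * (c / 2 * n) := by ring
    linarith
  exact le_of_mul_le_mul_left this hnpos

/-- Induct on r: blow up the r-tuples having many extensions, then apply the bipartite pigeonhole to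
those tuples against their extending vertices. Membership in F is kept in the conclusion so that the
tuples found still have many extensions. -/
theorem exists_blowup_of_many_cliques (r : ℕ) : ∀ c : ℝ, 0 < c → ∃ δ : ℝ, 0 < δ ∧ ∃ n₀ : ℕ,
    ∀ (V : Type u) [Fintype V] (G : SimpleGraph V) (F : Finset (Fin r → V)),
      (∀ f ∈ F, ∀ i j, i ≠ j → G.Adj (f i) (f j)) → n₀ ≤ Fintype.card V →
      c * (Fintype.card V : ℝ) ^ r ≤ F.card →
      ∀ t : ℕ, (t : ℝ) ≤ δ * Real.log (Fintype.card V) →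
        ∃ f : Fin t → Fin r → V, (∀ a, f a ∈ F) ∧ (∀ i, Function.Injective fun a => f a i) ∧
          ∀ i j, i ≠ j → ∀ a b, G.Adj (f a i) (f b j) := by
  classical
  induction r with
  | zero =>
    intro c hc
    refine ⟨1, one_pos, 0, fun V _ G F _ _ hF t _ => ?_⟩
    have : (0 : ℝ) < F.card := by
      refine lt_of_lt_of_le ?_ hF
      simpa using hc
    obtain ⟨f, hf⟩ := Finset.card_pos.1 (Nat.cast_pos.1 this)
    exact ⟨fun _ => f, fun _ => hf, fun i => i.elim0, fun i => i.elim0⟩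
  | succ r ih =>
    intro c hc
    obtain ⟨δ, hδ, n₁, h₁⟩ := ih (c / 2) (by positivity)
    -- The factor 4 / c + 1 pays for passing from t to s, rounding included; the cap 1 / 2 gives 2 ^
    -- s ≤ √n.
    set δ' := min δ (1 / 2) / (4 / c + 1) with hδ'
    have hδ'pos : 0 < δ' := by positivity
    obtain ⟨n₂, hn₂⟩ : ∃ n₂ : ℕ, ∀ n : ℕ, n₂ ≤ n →
        δ' * Real.log n ≤ c / 4 * (n : ℝ) ^ (1 / 2 : ℝ) := by
      have h := (isLittleO_log_rpow_atTop (r := 1 / 2) (by norm_num)).bound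
        (c := c / 4 / δ') (by positivity)
      have h' := (tendsto_natCast_atTop_atTop (R := ℝ)).eventually h
      obtain ⟨N, hN⟩ := Filter.eventually_atTop.1 h'
      refine ⟨N, fun n hn => ?_⟩
      have := (le_abs_self _).trans (hN n hn)
      rw [Real.norm_of_nonneg (by positivity)] at this
      calc δ' * Real.log n ≤ δ' * (c / 4 / δ' * (n : ℝ) ^ (1 / 2 : ℝ)) := by gcongr
        _ = _ := by field_simp
    refine ⟨δ', hδ'pos, max (max n₁ n₂) 1, fun V _ G F hcl hn hF t ht => ?_⟩
    set n := Fintype.card V with hnV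
    have hn1 : 1 ≤ n := (le_max_right _ _).trans hn
    have hnn₁ : n₁ ≤ n := ((le_max_left _ _).trans (le_max_left _ _)).trans hn
    have hnn₂ : n₂ ≤ n := ((le_max_right _ _).trans (le_max_left _ _)).trans hn
    have hnR : (0 : ℝ) < n := by exact_mod_cast hn1
    rcases Nat.eq_zero_or_pos t with rfl | htpos
    · exact ⟨fun a => a.elim0, fun a => a.elim0, fun _ a => a.elim0, fun _ _ _ a => a.elim0⟩
    have ht1 : (1 : ℝ) ≤ t := by exact_mod_cast htpos
    set s := ⌈4 / c * t⌉₊ with hs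
    have hs_ge : 4 / c * t ≤ s := Nat.le_ceil _
    have hs_pos : 0 < s := Nat.ceil_pos.2 (by positivity)
    have hs_le : (s : ℝ) ≤ min δ (1 / 2) * Real.log n := by
      have h1 : (s : ℝ) ≤ (4 / c + 1) * t := by
        have := Nat.ceil_lt_add_one (a := 4 / c * (t : ℝ)) (by positivity)
        linarith
      calc (s : ℝ) ≤ (4 / c + 1) * t := h1
        _ ≤ (4 / c + 1) * (δ' * Real.log n) := by gcongr
        _ = _ := by rw [hδ']; field_simp
    have hlog : 0 ≤ Real.log n := Real.log_natCast_nonneg n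
    set F' := Finset.univ.filter fun h : Fin r → V => c / 2 * n ≤
        ((Finset.univ.filter fun v : V => (Fin.cons v h : Fin (r + 1) → V) ∈ F).card : ℝ) with hF'
    have hF'card := card_filter_cons_ge F (c := c) hn1 hF
    have hF'cl : ∀ f ∈ F', ∀ i j, i ≠ j → G.Adj (f i) (f j) := by
      intro f hf i j hij
      have h1 : (0 : ℝ) <
          ((Finset.univ.filter fun v : V => (Fin.cons v f : Fin (r + 1) → V) ∈ F).card : ℝ) :=
        lt_of_lt_of_le (by positivity) (Finset.mem_filter.1 hf).2
      obtain ⟨v, hv⟩ := Finset.card_pos.1 (Nat.cast_pos.1 h1)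
      simpa using hcl _ (Finset.mem_filter.1 hv).2 i.succ j.succ (by simpa using hij)
    obtain ⟨g, hgF, hginj, hgadj⟩ := h₁ V G F' hF'cl hnn₁ hF'card s
      (hs_le.trans (by gcongr; exact min_le_left _ _))
    have : Nonempty (Fin s) := ⟨⟨0, hs_pos⟩⟩
    have hpow : (2 : ℝ) ^ s ≤ (n : ℝ) ^ (1 / 2 : ℝ) := by
      calc (2 : ℝ) ^ s ≤ Real.exp 1 ^ s := by
            gcongr
            have := Real.add_one_le_exp 1
            linarith
        _ = Real.exp s := by rw [← Real.exp_nat_mul, mul_one]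
        _ ≤ Real.exp (Real.log n * (1 / 2)) := by
            gcongr
            calc (s : ℝ) ≤ min δ (1 / 2) * Real.log n := hs_le
              _ ≤ 1 / 2 * Real.log n := by gcongr; exact min_le_right _ _
              _ = _ := by ring
        _ = _ := by rw [Real.rpow_def_of_pos hnR]
    obtain ⟨e, w, hew⟩ := exists_complete_bipartite
      (fun (a : Fin s) (v : V) => (Fin.cons v (g a) : Fin (r + 1) → V) ∈ F) (β := c / 2)
      (by positivity) (fun a => (Finset.mem_filter.1 (hgF a)).2) (t := t) (by
        rw [Fintype.card_fin]
        calc (t : ℝ) = c / 2 / 2 * (4 / c * t) := by field_simp; norm_num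
          _ ≤ _ := by gcongr) (by
        rw [Fintype.card_fin]
        calc (t : ℝ) * 2 ^ s ≤ (c / 4 * (n : ℝ) ^ (1 / 2 : ℝ)) * (n : ℝ) ^ (1 / 2 : ℝ) := by
              gcongr
              exact ht.trans (hn₂ n hnn₂)
          _ = c / 2 / 2 * n := by
              rw [mul_assoc, ← Real.rpow_add hnR, add_halves, Real.rpow_one]; ring)
    -- The diagonal pairing suffices for membership in F; adjacency across different indices uses
    -- the whole bipartite pattern.
    refine ⟨fun a => Fin.cons (w a) (g (e a)), fun a => hew a a, fun i => ?_, ?_⟩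
    · refine Fin.cases ?_ (fun i => ?_) i
      · simpa using w.injective
      · simpa [Function.comp_def] using (hginj i).comp e.injective
    · intro i j
      refine Fin.cases ?_ (fun i => ?_) i <;> refine Fin.cases ?_ (fun j => ?_) j
      · simp
      · intro _ a b
        simpa using hcl _ (hew b a) 0 j.succ (Fin.succ_ne_zero j).symm
      · intro _ a b
        simpa using hcl _ (hew a b) i.succ 0 (Fin.succ_ne_zero i)
      · intro hij a b
        simpa using hgadj i j (by simpa using hij) (e a) (e b)

/-! ### Supersaturation by averaging over maps from a bounded set -/

theorem Fintype.sum_comp_embedding {α β V : Type*} [Fintype α] [Fintype β] [Fintype V]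
    [DecidableEq α] [DecidableEq β] (e : α ↪ β) (F : (α → V) → ℝ) :
    ∑ φ : β → V, F (φ ∘ e) =
      (Fintype.card V : ℝ) ^ (Fintype.card β - Fintype.card α) * ∑ ψ : α → V, F ψ := by
  classical
  let E : (β → V) ≃ (α → V) × ({b // b ∉ Set.range e} → V) :=
    (Equiv.piEquivPiSubtypeProd (fun b => b ∈ Set.range e) fun _ => V).trans
      (Equiv.prodCongr ((Equiv.ofInjective e e.injective).arrowCongr (Equiv.refl V)).symm
        (Equiv.refl _))
  have hE : ∀ φ, F (φ ∘ e) = F (E φ).1 := fun φ => rfl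
  simp only [hE]
  rw [E.sum_comp (fun p => F p.1), Fintype.sum_prod_type]
  have hcard : Fintype.card {b // b ∉ Set.range e} = Fintype.card β - Fintype.card α := by
    rw [Fintype.card_subtype_compl]
    congr 1
    exact (Fintype.card_congr (Equiv.ofInjective e e.injective)).symm
  simp only [Finset.sum_const, Finset.card_univ, Fintype.card_fun, hcard, nsmul_eq_mul,
    Nat.cast_pow, Finset.mul_sum]

namespace SimpleGraph

theorem adjMatrix_nonneg {V : Type*} (G : SimpleGraph V) [DecidableRel G.Adj] (u v : V) : 0 ≤ G.adjMatrix ℝ u v := by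
  rw [adjMatrix_apply]; split_ifs <;> norm_num

variable {V : Type*} [Fintype V] (G : SimpleGraph V) [DecidableRel G.Adj]

theorem cast_degree_eq_sum_adjMatrix (v : V) : (G.degree v : ℝ) = ∑ w, G.adjMatrix ℝ v w := by
  simp [← card_neighborFinset_eq_degree, neighborFinset_eq_filter]

/-- Homomorphisms from a clique on `r` labelled vertices. -/
def cliqueTuples [DecidableEq V] (r : ℕ) : Finset (Fin r → V) :=
  Finset.univ.filter fun f => ∀ i j, i ≠ j → G.Adj (f i) (f j)

theorem sum_sum_sq_degree_comap_ge (M : ℕ) :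
    ((M : ℝ) - 3) * M ^ 2 * ((Fintype.card V : ℝ) ^ (M - 3) * ∑ v, (G.degree v : ℝ) ^ 2) ≤
      ∑ φ : Fin M → V, ∑ i, ((G.comap φ).degree i : ℝ) ^ 2 := by
  classical
  set C := (Fintype.card V : ℝ) ^ (M - 3) * ∑ v, (G.degree v : ℝ) ^ 2 with hC
  have hC0 : 0 ≤ C := by positivity
  let a := fun u v => G.adjMatrix ℝ u v
  have ha : ∀ u v, 0 ≤ a u v := G.adjMatrix_nonneg
  have hsq : ∀ φ : Fin M → V, ∑ i, ((G.comap φ).degree i : ℝ) ^ 2 =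
      ∑ i, ∑ j, ∑ l, a (φ i) (φ j) * a (φ i) (φ l) := by
    intro φ
    refine Finset.sum_congr rfl fun i _ => ?_
    rw [cast_degree_eq_sum_adjMatrix, sq, Finset.sum_mul_sum]
    rfl
  have hS : ∑ v, (G.degree v : ℝ) ^ 2 = ∑ ψ : Fin 3 → V, a (ψ 0) (ψ 1) * a (ψ 0) (ψ 2) := by
    rw [← (Fin.consEquiv fun _ : Fin 3 => V).sum_comp, Fintype.sum_prod_type]
    refine Finset.sum_congr rfl fun v _ => ?_
    rw [← (finTwoArrowEquiv V).symm.sum_comp, Fintype.sum_prod_type,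
      cast_degree_eq_sum_adjMatrix, sq, Finset.sum_mul_sum]
    rfl
  -- The bound is an equality for distinct indices and trivial otherwise; its indicators sum to M³ -
  -- 3M².
  have hterm : ∀ i j l : Fin M,
      C * (1 - (if i = j then 1 else 0) - (if i = l then 1 else 0) - (if j = l then 1 else 0)) ≤
        ∑ φ : Fin M → V, a (φ i) (φ j) * a (φ i) (φ l) := by
    intro i j l
    have h0 : 0 ≤ ∑ φ : Fin M → V, a (φ i) (φ j) * a (φ i) (φ l) :=
      Finset.sum_nonneg fun φ _ => mul_nonneg (ha _ _) (ha _ _)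
    by_cases h : i ≠ j ∧ i ≠ l ∧ j ≠ l
    · obtain ⟨hij, hil, hjl⟩ := h
      have hinj : Function.Injective ![i, j, l] := by
        intro x y
        fin_cases x <;> fin_cases y <;> simp [hij, hil, hjl, hij.symm, hil.symm, hjl.symm]
      have := Fintype.sum_comp_embedding (V := V) ⟨![i, j, l], hinj⟩
        (fun ψ => a (ψ 0) (ψ 1) * a (ψ 0) (ψ 2))
      rw [← hS, Fintype.card_fin, Fintype.card_fin] at this
      simp only [hij, hil, hjl, if_false, sub_zero, mul_one]
      exact this.symm.le
    · refine le_trans (mul_nonpos_of_nonneg_of_nonpos hC0 ?_) h0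
      by_cases h1 : i = j <;> by_cases h2 : i = l <;> by_cases h3 : j = l <;> simp_all
  calc ((M : ℝ) - 3) * M ^ 2 * C = ∑ i : Fin M, ∑ j : Fin M, ∑ l : Fin M,
        C * (1 - (if i = j then 1 else 0) - (if i = l then 1 else 0) -
          (if j = l then 1 else 0)) := by
        simp only [← Finset.mul_sum, Finset.sum_sub_distrib]
        simp
        ring
    _ ≤ ∑ i : Fin M, ∑ j : Fin M, ∑ l : Fin M,
        ∑ φ : Fin M → V, a (φ i) (φ j) * a (φ i) (φ l) :=
        Finset.sum_le_sum fun i _ => Finset.sum_le_sum fun j _ => Finset.sum_le_sum fun l _ =>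
          hterm i j l
    _ = ∑ φ : Fin M → V, ∑ i, ((G.comap φ).degree i : ℝ) ^ 2 := by
        simp only [hsq]
        symm
        rw [Finset.sum_comm]
        refine Finset.sum_congr rfl fun i _ => ?_
        rw [Finset.sum_comm]
        exact Finset.sum_congr rfl fun j _ => Finset.sum_comm

theorem sum_sum_degree_comap_le (M : ℕ) :
    ∑ φ : Fin M → V, ∑ i, ((G.comap φ).degree i : ℝ) ≤
      M ^ 2 * ((Fintype.card V : ℝ) ^ (M - 2) * ∑ v, (G.degree v : ℝ)) := by
  classical
  set C := (Fintype.card V : ℝ) ^ (M - 2) * ∑ v, (G.degree v : ℝ) with hC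
  have hC0 : 0 ≤ C := by positivity
  let a := fun u v => G.adjMatrix ℝ u v
  have hS : ∑ v, (G.degree v : ℝ) = ∑ ψ : Fin 2 → V, a (ψ 0) (ψ 1) := by
    rw [← (finTwoArrowEquiv V).symm.sum_comp, Fintype.sum_prod_type]
    refine Finset.sum_congr rfl fun v _ => ?_
    rw [cast_degree_eq_sum_adjMatrix]
    rfl
  have hterm : ∀ i j : Fin M, ∑ φ : Fin M → V, a (φ i) (φ j) ≤ C := by
    intro i j
    by_cases hij : i = j
    · subst hij
      simpa [a] using hC0
    · have hinj : Function.Injective ![i, j] := by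
        intro x y
        fin_cases x <;> fin_cases y <;> simp [hij, Ne.symm hij]
      have := Fintype.sum_comp_embedding (V := V) ⟨![i, j], hinj⟩ (fun ψ => a (ψ 0) (ψ 1))
      rw [← hS, Fintype.card_fin, Fintype.card_fin] at this
      exact this.le
  calc ∑ φ : Fin M → V, ∑ i, ((G.comap φ).degree i : ℝ)
      = ∑ φ : Fin M → V, ∑ i, ∑ j, a (φ i) (φ j) := by
        simp only [cast_degree_eq_sum_adjMatrix]; rfl
    _ = ∑ i : Fin M, ∑ j : Fin M, ∑ φ : Fin M → V, a (φ i) (φ j) := by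
        rw [Finset.sum_comm]
        exact Finset.sum_congr rfl fun i _ => Finset.sum_comm
    _ ≤ ∑ _i : Fin M, ∑ _j : Fin M, C :=
        Finset.sum_le_sum fun i _ => Finset.sum_le_sum fun j _ => hterm i j
    _ = M ^ 2 * C := by simp; ring

/-- Without a clique the left side is nonpositive; otherwise the crude bound M³ is paid for by a
single clique. -/
theorem sum_sq_degree_sub_le {M k : ℕ} (hk : 2 ≤ k) (H : SimpleGraph (Fin M))
    [DecidableRel H.Adj] :
    ∑ i, (H.degree i : ℝ) ^ 2 - (1 - 1 / (k : ℝ)) * M * ∑ i, (H.degree i : ℝ) ≤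
      M ^ 3 * (Finset.univ.filter fun e : Fin (k + 1) ↪ Fin M =>
        ∀ i j, i ≠ j → H.Adj (e i) (e j)).card := by
  by_cases hH : H.CliqueFree (k + 1)
  · have := sum_sq_degree_le_of_cliqueFree H hk hH
    rw [Fintype.card_fin] at this
    have h0 : (0 : ℝ) ≤ M ^ 3 * (Finset.univ.filter fun e : Fin (k + 1) ↪ Fin M =>
        ∀ i j, i ≠ j → H.Adj (e i) (e j)).card := by positivity
    linarith
  · have h1 : (1 : ℝ) ≤ (Finset.univ.filter fun e : Fin (k + 1) ↪ Fin M =>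
        ∀ i j, i ≠ j → H.Adj (e i) (e j)).card := by
      rw [Nat.one_le_cast, Nat.one_le_iff_ne_zero, ← Nat.pos_iff_ne_zero, Finset.card_pos]
      let f := topEmbeddingOfNotCliqueFree hH
      exact ⟨f.toEmbedding, by simp⟩
    have hα : (0 : ℝ) ≤ 1 - 1 / (k : ℝ) := by
      have : (2 : ℝ) ≤ k := by exact_mod_cast hk
      rw [sub_nonneg, div_le_one] <;> linarith
    have h2 : 0 ≤ (1 - 1 / (k : ℝ)) * M * ∑ i, (H.degree i : ℝ) :=
      mul_nonneg (mul_nonneg hα (Nat.cast_nonneg _))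
        (Finset.sum_nonneg fun _ _ => Nat.cast_nonneg _)
    have h3 : ∑ i, (H.degree i : ℝ) ^ 2 ≤ M ^ 3 := by
      calc ∑ i, (H.degree i : ℝ) ^ 2 ≤ ∑ _i : Fin M, (M : ℝ) ^ 2 := by
            gcongr with i
            simpa using (H.degree_lt_card_verts i).le
        _ = _ := by simp; ring
    have h4 : (M : ℝ) ^ 3 * 1 ≤ M ^ 3 * (Finset.univ.filter fun e : Fin (k + 1) ↪ Fin M =>
        ∀ i j, i ≠ j → H.Adj (e i) (e j)).card := by gcongr
    linarith

theorem sum_card_clique_embeddings_le [DecidableEq V] (M r : ℕ) :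
    ∑ φ : Fin M → V, ((Finset.univ.filter fun e : Fin r ↪ Fin M =>
        ∀ i j, i ≠ j → (G.comap φ).Adj (e i) (e j)).card : ℝ) ≤
      M ^ r * ((Fintype.card V : ℝ) ^ (M - r) * (G.cliqueTuples r).card) := by
  calc ∑ φ : Fin M → V, ((Finset.univ.filter fun e : Fin r ↪ Fin M =>
        ∀ i j, i ≠ j → (G.comap φ).Adj (e i) (e j)).card : ℝ)
      = ∑ e : Fin r ↪ Fin M, ∑ φ : Fin M → V,
          if φ ∘ e ∈ G.cliqueTuples r then (1 : ℝ) else 0 := by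
        rw [Finset.sum_comm]
        refine Finset.sum_congr rfl fun φ _ => ?_
        simp [cliqueTuples]
    _ = ∑ _e : Fin r ↪ Fin M, (Fintype.card V : ℝ) ^ (M - r) * (G.cliqueTuples r).card := by
        refine Finset.sum_congr rfl fun e _ => ?_
        rw [Fintype.sum_comp_embedding e fun ψ => if ψ ∈ G.cliqueTuples r then (1 : ℝ) else 0]
        simp
    _ ≤ _ := by
        rw [Finset.sum_const, nsmul_eq_mul, Finset.card_univ, Fintype.card_embedding_eq]
        gcongr
        simp only [Fintype.card_fin]
        exact_mod_cast Nat.descFactorial_le_pow M r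

theorem sum_degree_mul_le_card_cliqueTuples [DecidableEq V] {k M : ℕ} (hk : 2 ≤ k) {ε : ℝ}
    (hε : 0 < ε) (hV : 0 < Fintype.card V) (hM : 4 / ε + 3 ≤ M) (hkM : k + 1 ≤ M)
    (h : (1 - 1 / (k : ℝ) + ε) * (∑ v, (G.degree v : ℝ)) * Fintype.card V ≤
      ∑ v, (G.degree v : ℝ) ^ 2) :
    (∑ v, (G.degree v : ℝ)) * (Fintype.card V : ℝ) ^ (k - 1) ≤
      M ^ (k + 2) * (G.cliqueTuples (k + 1)).card := by
  have hM3 : 3 ≤ M := by omega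
  set n : ℝ := (Fintype.card V : ℝ) with hn
  have hnpos : 0 < n := Nat.cast_pos.2 hV
  set D := ∑ v, (G.degree v : ℝ) with hD
  have hD0 : 0 ≤ D := by positivity
  set T : ℝ := ((G.cliqueTuples (k + 1)).card : ℝ) with hT
  set α : ℝ := 1 - 1 / (k : ℝ) with hα
  have hα0 : 0 ≤ α := by
    have : (2 : ℝ) ≤ k := by exact_mod_cast hk
    rw [hα, sub_nonneg, div_le_one] <;> linarith
  have hα1 : α ≤ 1 := by
    have : (0 : ℝ) ≤ 1 / k := by positivity
    linarith
  have hMR : (3 : ℝ) ≤ M := by exact_mod_cast hM3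
  have hMpos : (0 : ℝ) < M := by linarith
  have h1 := G.sum_sum_sq_degree_comap_ge M
  have h2 := G.sum_sum_degree_comap_le M
  have h3 := G.sum_card_clique_embeddings_le M (k + 1)
  rw [← hn, ← hD] at h2
  rw [← hn, ← hT] at h3
  rw [← hn] at h1
  have h4 : ∑ φ : Fin M → V, (∑ i, ((G.comap φ).degree i : ℝ) ^ 2 -
      α * M * ∑ i, ((G.comap φ).degree i : ℝ)) ≤
      ∑ φ : Fin M → V, (M : ℝ) ^ 3 * ((Finset.univ.filter fun e : Fin (k + 1) ↪ Fin M =>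
        ∀ i j, i ≠ j → (G.comap φ).Adj (e i) (e j)).card : ℝ) :=
    Finset.sum_le_sum fun φ _ => sum_sq_degree_sub_le hk (G.comap φ)
  rw [Finset.sum_sub_distrib, ← Finset.mul_sum, ← Finset.mul_sum] at h4
  have h5 : (M : ℝ) ^ 3 * ∑ φ : Fin M → V, ((Finset.univ.filter fun e : Fin (k + 1) ↪ Fin M =>
        ∀ i j, i ≠ j → (G.comap φ).Adj (e i) (e j)).card : ℝ) ≤
      M ^ 3 * (M ^ (k + 1) * (n ^ (M - (k + 1)) * T)) := by gcongr
  have h6 : α * M * ∑ φ : Fin M → V, ∑ i, ((G.comap φ).degree i : ℝ) ≤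
      α * M * (M ^ 2 * (n ^ (M - 2) * D)) := by gcongr
  have h7 : ((M : ℝ) - 3) * M ^ 2 * (n ^ (M - 3) * ((α + ε) * D * n)) ≤
      ((M : ℝ) - 3) * M ^ 2 * (n ^ (M - 3) * ∑ v, (G.degree v : ℝ) ^ 2) := by
    have : (0 : ℝ) ≤ (M : ℝ) - 3 := by linarith
    gcongr
  have e1 : n ^ (M - 2) = n ^ (M - 3) * n := by rw [← pow_succ]; congr 1; omega
  -- The bracket equals (M - 3)ε - 3α, at least 4 - 3 = 1 by the choice of M.
  have h8 : (M : ℝ) ^ 2 * (n ^ (M - 2) * D) ≤ M ^ 2 * (n ^ (M - 2) * D) *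
      ((M - 3) * (α + ε) - α * M) := by
    refine le_mul_of_one_le_right (by positivity) ?_
    have : 4 ≤ (M - 3) * ε := by
      rw [← div_le_iff₀ hε]; linarith
    nlinarith
  have h9 : (M : ℝ) ^ 2 * (n ^ (M - 2) * D) ≤ M ^ 3 * (M ^ (k + 1) * (n ^ (M - (k + 1)) * T)) := by
    have : M ^ 2 * (n ^ (M - 2) * D) * ((M - 3) * (α + ε) - α * M) =
      ((M : ℝ) - 3) * M ^ 2 * (n ^ (M - 3) * ((α + ε) * D * n)) -
        α * M * (M ^ 2 * (n ^ (M - 2) * D)) := by rw [e1]; ring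
    linarith
  have e2 : n ^ (M - 2) = n ^ (M - (k + 1)) * n ^ (k - 1) := by
    rw [← pow_add]; congr 1; omega
  have hpos : 0 < (M : ℝ) ^ 2 * n ^ (M - (k + 1)) := by positivity
  refine le_of_mul_le_mul_left ?_ hpos
  calc (M : ℝ) ^ 2 * n ^ (M - (k + 1)) * (D * n ^ (k - 1)) = M ^ 2 * (n ^ (M - 2) * D) := by
        rw [e2]; ring
    _ ≤ _ := h9
    _ = _ := by ring

/-! ### Density by counting triangles -/

/-- If `∑ d(v)²` is large compared with the number of edges, then the graph is dense. -/
theorem sq_card_le_sum_degree {ε : ℝ} (hε : 0 < ε) (hD : 0 < ∑ v, (G.degree v : ℝ))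
    (h : (1 / 2 + ε) * (∑ v, (G.degree v : ℝ)) * Fintype.card V ≤ ∑ v, (G.degree v : ℝ) ^ 2) :
    4 * ε ^ 2 * (Fintype.card V : ℝ) ^ 2 ≤ ∑ v, (G.degree v : ℝ) := by
  set n : ℝ := (Fintype.card V : ℝ) with hn
  set D := ∑ v, (G.degree v : ℝ) with hDdef
  set S := ∑ v, (G.degree v : ℝ) ^ 2 with hS
  let a := fun u v => G.adjMatrix ℝ u v
  have hdeg : ∀ v, (G.degree v : ℝ) = ∑ w, a v w := G.cast_degree_eq_sum_adjMatrix
  have hsymm : ∀ u v, a u v = a v u := fun u v => by simp [a, adj_comm]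
  have ha : ∀ u v, a u v = 0 ∨ a u v = 1 := fun u v => by
    by_cases h : G.Adj u v <;> simp [a, h]
  set τ := ∑ u, ∑ v, ∑ w, a u v * a u w * a v w with hτ
  -- Pointwise x(y + z - 1) ≤ xyz for x, y, z in {0, 1}.
  have hlow : 2 * S - n * D ≤ τ := by
    have e1 : ∑ u, ∑ v, ∑ w, a u v * a u w = S := by
      refine Finset.sum_congr rfl fun u _ => ?_
      rw [hdeg, sq, Finset.sum_mul_sum]
    have e2 : ∑ u, ∑ v, ∑ w, a u v * a v w = S := by
      rw [Finset.sum_comm]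
      refine Finset.sum_congr rfl fun v _ => ?_
      rw [hdeg, sq, Finset.sum_mul_sum]
      simp only [hsymm v]
    have e3 : ∑ u, ∑ v, ∑ _w : V, a u v = n * D := by
      simp only [hDdef, hdeg, Finset.mul_sum]
      simp [hn]
    calc 2 * S - n * D = ∑ u, ∑ v, ∑ w, (a u v * a u w + a u v * a v w - a u v) := by
          simp only [Finset.sum_sub_distrib, Finset.sum_add_distrib, e1, e2, e3]; ring
      _ ≤ τ := by
          refine Finset.sum_le_sum fun u _ => Finset.sum_le_sum fun v _ =>
            Finset.sum_le_sum fun w _ => ?_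
          rcases ha u v with h1 | h1 <;> rcases ha u w with h2 | h2 <;>
            rcases ha v w with h3 | h3 <;> simp [h1, h2, h3]
  have hup : τ ≤ D * √D := by
    rw [hDdef, Finset.sum_mul, ← hDdef]
    refine Finset.sum_le_sum fun u _ => ?_
    have a0 : ∀ x y, 0 ≤ a x y := G.adjMatrix_nonneg
    have a1 : ∀ x y, a x y ≤ 1 := fun x y => by rcases ha x y with h | h <;> simp [h]
    have b1 : ∑ v, ∑ w, a u v * a u w * a v w ≤ (G.degree u : ℝ) ^ 2 := by
      rw [hdeg, sq, Finset.sum_mul_sum]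
      refine Finset.sum_le_sum fun v _ => Finset.sum_le_sum fun w _ => ?_
      exact mul_le_of_le_one_right (mul_nonneg (a0 _ _) (a0 _ _)) (a1 _ _)
    have b2 : ∑ v, ∑ w, a u v * a u w * a v w ≤ D := by
      simp only [hDdef, hdeg]
      refine Finset.sum_le_sum fun v _ => Finset.sum_le_sum fun w _ => ?_
      exact mul_le_of_le_one_left (a0 _ _) (mul_le_one₀ (a1 _ _) (a0 _ _) (a1 _ _))
    -- The ordered triangles at u number at most min(d(u)², D) ≤ d(u)√D.
    rcases le_total (G.degree u : ℝ) √D with hle | hle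
    · refine b1.trans ?_
      rw [sq]
      exact mul_le_mul_of_nonneg_left hle (Nat.cast_nonneg _)
    · refine b2.trans ?_
      calc D = √D * √D := (Real.mul_self_sqrt hD.le).symm
        _ ≤ G.degree u * √D := mul_le_mul_of_nonneg_right hle (Real.sqrt_nonneg _)
  have h1 : D * (2 * ε * n) ≤ D * √D := by nlinarith
  have h2 := le_of_mul_le_mul_left h1 hD
  calc 4 * ε ^ 2 * n ^ 2 = (2 * ε * n) ^ 2 := by ring
    _ ≤ √D ^ 2 := by gcongr
    _ = D := Real.sq_sqrt hD.le

/-! ### From labelled cliques to copies -/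

/-- All labelled copies with the same image subgraph take values in its vertex set, of size at most
r, so each subgraph is hit at most r^r times. -/
theorem card_cliqueTuples_le [DecidableEq V] (r : ℕ) :
    (G.cliqueTuples r).card ≤ r ^ r * G.copyCount (⊤ : SimpleGraph (Fin r)) := by
  classical
  have h1 : (G.cliqueTuples r).card ≤
      (Finset.univ : Finset (Copy (⊤ : SimpleGraph (Fin r)) G)).card := by
    rw [← Finset.card_image_of_injective _ (DFunLike.coe_injective (F := Copy _ G))]
    refine Finset.card_le_card fun f hf => ?_
    have hf' : ∀ i j, i ≠ j → G.Adj (f i) (f j) := by simpa [cliqueTuples] using hf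
    refine Finset.mem_image.2 ⟨⟨⟨f, fun {i j} hij => hf' i j hij⟩, fun i j hij => ?_⟩,
      Finset.mem_univ _, rfl⟩
    by_contra hne
    exact (hf' i j hne).ne hij
  refine h1.trans ?_
  rw [copyCount_eq_card_image_copyToSubgraph]
  refine Finset.card_le_mul_card_image _ _ fun H hH => ?_
  obtain ⟨c₀, -, hc₀⟩ := Finset.mem_image.1 hH
  have hsub : (Finset.univ.filter fun c : Copy (⊤ : SimpleGraph (Fin r)) G =>
      c.toSubgraph = H).image (fun c : Copy (⊤ : SimpleGraph (Fin r)) G => (c : Fin r → V)) ⊆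
      Fintype.piFinset fun _ => Finset.univ.image c₀ := by
    intro f hf
    obtain ⟨c, hc, rfl⟩ := Finset.mem_image.1 hf
    rw [Fintype.mem_piFinset]
    intro i
    have hcc : c.toSubgraph = c₀.toSubgraph := by
      rw [hc₀]; exact (Finset.mem_filter.1 hc).2
    have hv := congrArg Subgraph.verts hcc
    have : c i ∈ c.toSubgraph.verts := by simp [Copy.toSubgraph]
    rw [hv] at this
    simpa [Copy.toSubgraph] using this
  rw [← Finset.card_image_of_injective _ (DFunLike.coe_injective (F := Copy _ G))]
  refine (Finset.card_le_card hsub).trans ?_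
  rw [Fintype.card_piFinset]
  simp only [Finset.prod_const, Finset.card_univ, Fintype.card_fin]
  gcongr
  exact Finset.card_image_le.trans (by simp)

end SimpleGraph

/-! ### Assembly -/

theorem theorem7p1 (k : ℕ) (hk : 2 ≤ k) (ε : ℝ) (hε : 0 < ε) :
    ∃ c₁ c₂ : ℝ, 0 < c₁ ∧ 0 < c₂ ∧ ∃ n₀ : ℕ,
      ∀ (V : Type u) [Fintype V] [DecidableEq V] (G : SimpleGraph V) [DecidableRel G.Adj]
        (n m : ℕ), Fintype.card V = n → G.edgeFinset.card = m → n₀ ≤ n → 1 ≤ m →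
        2 * (1 - 1 / (k : ℝ) + ε) * (m : ℝ) * (n : ℝ) ≤ ∑ v : V, (G.degree v : ℝ) ^ 2 →
        c₁ * (n : ℝ) ^ (k + 1) ≤ (G.copyCount (⊤ : SimpleGraph (Fin (k + 1))) : ℝ) ∧
        ∃ t : ℕ, c₂ * Real.log (n : ℝ) ≤ (t : ℝ) ∧
          (SimpleGraph.completeEquipartiteGraph (k + 1) t).IsContained G := by
  obtain ⟨M, hM⟩ := exists_nat_ge (max (4 / ε + 3) ((k + 1 : ℕ) : ℝ))
  have hMε : 4 / ε + 3 ≤ M := (le_max_left _ _).trans hM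
  have hMk : k + 1 ≤ M := by exact_mod_cast (le_max_right _ _).trans hM
  have hMpos : (0 : ℝ) < M := by
    have : 0 < M := by omega
    exact_mod_cast this
  set c : ℝ := 4 * ε ^ 2 / M ^ (k + 2) with hc
  have hcpos : 0 < c := by positivity
  obtain ⟨δ, hδ, n₁, hblow⟩ := exists_blowup_of_many_cliques.{u} (k + 1) c hcpos
  -- Once δ log n ≥ 2, rounding it down still leaves at least (δ / 2) log n.
  obtain ⟨n₂, hn₂⟩ : ∃ n₂ : ℕ, ∀ n : ℕ, n₂ ≤ n → 2 ≤ δ * Real.log n := by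
    have h := (Real.tendsto_log_atTop.comp (tendsto_natCast_atTop_atTop (R := ℝ))).eventually_ge_atTop
      (2 / δ)
    obtain ⟨N, hN⟩ := Filter.eventually_atTop.1 h
    refine ⟨N, fun n hn => ?_⟩
    have : 2 / δ ≤ Real.log n := hN n hn
    rwa [div_le_iff₀ hδ, mul_comm] at this
  refine ⟨c / ((k + 1 : ℕ) : ℝ) ^ (k + 1), δ / 2, by positivity, by positivity, max n₁ n₂, ?_⟩
  intro V _ _ G _ n m hn hm hnge hm1 hG
  subst hn hm
  have hD : ∑ v, (G.degree v : ℝ) = 2 * G.edgeFinset.card := by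
    exact_mod_cast G.sum_degrees_eq_twice_card_edges
  have hDpos : 0 < ∑ v, (G.degree v : ℝ) := by
    have : (1 : ℝ) ≤ G.edgeFinset.card := by exact_mod_cast hm1
    linarith
  have hVpos : 0 < Fintype.card V := by
    by_contra! h0
    have : IsEmpty V := Fintype.card_eq_zero_iff.1 (by omega)
    simp at hDpos
  have hG' : (1 - 1 / (k : ℝ) + ε) * (∑ v, (G.degree v : ℝ)) * Fintype.card V ≤
      ∑ v, (G.degree v : ℝ) ^ 2 := by
    rw [hD]; linarith
  have hdense := G.sq_card_le_sum_degree hε hDpos (le_trans (by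
    have : 1 / (k : ℝ) ≤ 1 / 2 := by
      have : (2 : ℝ) ≤ k := by exact_mod_cast hk
      gcongr
    gcongr
    linarith) hG')
  have hT := G.sum_degree_mul_le_card_cliqueTuples hk hε hVpos hMε hMk hG'
  have hcl : c * (Fintype.card V : ℝ) ^ (k + 1) ≤ (G.cliqueTuples (k + 1)).card := by
    rw [hc, div_mul_eq_mul_div, div_le_iff₀ (by positivity), mul_comm _ ((M : ℝ) ^ (k + 2))]
    refine le_trans ?_ hT
    have : (Fintype.card V : ℝ) ^ (k + 1) =
        (Fintype.card V : ℝ) ^ 2 * (Fintype.card V : ℝ) ^ (k - 1) := by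
      rw [← pow_add]; congr 1; omega
    rw [this, ← mul_assoc]
    gcongr
  refine ⟨?_, ?_⟩
  · rw [div_mul_eq_mul_div, div_le_iff₀ (by positivity)]
    refine hcl.trans ?_
    rw [mul_comm]
    exact_mod_cast G.card_cliqueTuples_le (k + 1)
  · have hlog := hn₂ _ ((le_max_right _ _).trans hnge)
    refine ⟨⌊δ * Real.log (Fintype.card V)⌋₊, ?_, ?_⟩
    · have := Nat.lt_floor_add_one (δ * Real.log (Fintype.card V))
      linarith
    · obtain ⟨f, -, hinj, hadj⟩ := hblow V G (G.cliqueTuples (k + 1))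
        (fun f hf => by simpa [SimpleGraph.cliqueTuples] using hf)
        ((le_max_left _ _).trans hnge) hcl _ (Nat.floor_le (by linarith))
      refine ⟨⟨⟨fun p => f p.2 p.1, fun {p q} hpq => hadj _ _ hpq _ _⟩, ?_⟩⟩
      rintro ⟨i, a⟩ ⟨j, b⟩ hab
      by_cases hij : i = j
      · subst hij
        exact Prod.ext rfl (hinj i hab)
      · exact absurd hab (hadj i j hij a b).ne
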